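/- Let $1\le m<N$ be integers and let $H\in\mathbb{C}^{N\times N}$ be a Hermitian negative definite matrix with eigenvalues $\lambda_1\le\lambda_2\le\dots\le\lambda_N<0$ (counted with multiplicity). Assume $\lambda_m<\lambda_{m+1}$. For $\mu\ge 0$ and $X\in\mathbb{C}^{N\times m}$ put $$E_\mu(X)=\operatorname{tr}\bigl[(2I-X^*X)X^*HX\bigr]+\mu\sum_{i,j}|X_{ij}| ,$$ and let $S_\mu$ be the set of global minimizers of $E_\mu$ on $\mathbb{C}^{N\times m}$. Let $P_0$ be the orthogonal projector of $\mathbb{C}^N$ onto the low-lying eigenspace of $H$, that is, onto the span of the eigenvectors of $H$ belonging to $\lambda_1,\dots,\lambda_m$. Let $\|\cdot\|_F$ denote the Frobenius norm. Then for every $\alpha\in(0,1)$ there is $\mu_0>0$ such that for all $\mu$ with $0<\mu<\mu_0$ and all $X_\mu\in S_\mu$ the matrix $X_\mu^*X_\mu$ is invertible and $$\bigl\|X_\mu X_\mu^*-P_0\bigr\|_F\le\frac{2\mu m\sqrt N}{\alpha^2(\lambda_{m+1}-\lambda_m)},\qquad \bigl\|X_\mu(X_\mu^*X_\mu)^{-1}X_\mu^*-P_0\bigr\|_F\le\frac{4\mu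 m\sqrt N}{\alpha^2(\lambda_{m+1}-\lambda_m)} .$$ -/

import Mathlib

/-! Matrices carry the Frobenius norm. -/
attribute [local instance] Matrix.frobeniusNormedAddCommGroup

open scoped Matrix ComplexOrder

namespace OMM

noncomputable section

/-- The eigenvalues of a Hermitian `N × N` matrix, repeated with multiplicity and listed in
increasing order; the list starts at index `0`, so `eig hH k` is the `(k + 1)`-st smallest. -/
def eig {N : ℕ} {H : Matrix (Fin N) (Fin N) ℂ} (hH : H.IsHermitian) (k : Fin N) : ℝ :=
  hH.eigenvalues₀ (Fin.cast (Fintype.card_fin N).symm k.rev)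

/-- The OMM functional `tr[(2I - X*X) X*HX]`. For Hermitian `H` the trace is a real number, being
the trace of a product of two Hermitian matrices; the real part records it as an element of `ℝ`. -/
def E0 {N m : ℕ} (H : Matrix (Fin N) (Fin N) ℂ) (X : Matrix (Fin N) (Fin m) ℂ) : ℝ :=
  (((2 : ℂ) • (1 : Matrix (Fin m) (Fin m) ℂ) - Xᴴ * X) * (Xᴴ * H * X)).trace.re

/-- The entrywise `ℓ¹` norm. -/
def l1norm {N m : ℕ} (X : Matrix (Fin N) (Fin m) ℂ) : ℝ := ∑ i, ∑ j, ‖X i j‖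

/-- The OMM functional with an `ℓ¹` penalty. -/
def E {N m : ℕ} (H : Matrix (Fin N) (Fin N) ℂ) (μ : ℝ) (X : Matrix (Fin N) (Fin m) ℂ) : ℝ :=
  E0 H X + μ * l1norm X

/-- The set `S_μ` of global minimizers of `E_μ` over all `N × m` complex matrices. -/
def S {N : ℕ} (H : Matrix (Fin N) (Fin N) ℂ) (m : ℕ) (μ : ℝ) : Set (Matrix (Fin N) (Fin m) ℂ) :=
  {X | ∀ Y : Matrix (Fin N) (Fin m) ℂ, E H μ X ≤ E H μ Y}

/-- The low-lying eigenspace: the span of all eigenvectors belonging to the `m` smallest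
eigenvalues. It has dimension `m` when the `m`-th smallest eigenvalue is strictly below the
next one. -/
def lowEigenspace {N : ℕ} {H : Matrix (Fin N) (Fin N) ℂ} (hH : H.IsHermitian) (m : ℕ) :
    Submodule ℂ (EuclideanSpace ℂ (Fin N)) :=
  ⨆ k : Fin N, ⨆ _ : (k : ℕ) < m,
    Module.End.eigenspace (Matrix.toEuclideanLin H) ((eig hH k : ℝ) : ℂ)

/-- The matrix of the orthogonal projection of `ℂ^N` onto the low-lying eigenspace. -/
def P0 {N : ℕ} {H : Matrix (Fin N) (Fin N) ℂ} (hH : H.IsHermitian) (m : ℕ) :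
    Matrix (Fin N) (Fin N) ℂ :=
  Matrix.toEuclideanLin.symm ((lowEigenspace hH m).starProjection : _ →ₗ[ℂ] _)

/-- The approximate density matrix `X X*`. -/
def Ptilde {N m : ℕ} (X : Matrix (Fin N) (Fin m) ℂ) : Matrix (Fin N) (Fin N) ℂ := X * Xᴴ

/-- The matrix `X (X*X)⁻¹ X*`, the orthogonal projection onto the column space of `X` when the
columns of `X` are linearly independent. -/
def P {N m : ℕ} (X : Matrix (Fin N) (Fin m) ℂ) : Matrix (Fin N) (Fin N) ℂ :=
  X * (Xᴴ * X)⁻¹ * Xᴴ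

end

end OMM

/-! Let `P` be a projector with `P * X = X` and trace at most `m`, and let `K = P - X * Xᴴ`.
Completing the square (`E0_eq`) turns the energy into `tr (H P) - tr (H K Kᴴ)`. The spectral gap `g`
makes the first term grow quadratically in `‖P - P₀‖`, and `-H ≥ a P₀` does the same for the second
in `‖K‖`. So near the minimum the energy excess is at least `g / 2 * (‖P - P₀‖² + ‖K‖²)`, and this
sum controls `‖X * Xᴴ - P₀‖²` up to the factor `1 + ‖K‖` (`norm_sub_sq_le`).

For a minimizer of the penalized functional the excess is at most `μ` times a difference of `ℓ¹`
norms. Comparison with a fixed isometry `V` onto the range of `P₀` gives a crude bound that puts `X`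
near the minimum. There some `V * W` with `W` unitary has the same energy as `V` and lies within `d
= ‖X * Xᴴ - P₀‖` of `X` (`exists_isometry_near`), so the excess is at most `μ m √N d`. Dividing `g
d² ≤ 2 (1 + ε) μ m √N d` by `d` gives the first estimate; `α` absorbs `1 + ε`. The second costs a
factor 2, by the triangle inequality and `norm_P_sub_le`. -/

namespace OMM

/-! ### Frobenius norm inequalities and the polar factor. -/

section Frobenius

variable {l m n : Type*} [Fintype l] [Fintype m] [Fintype n]

lemma frobenius_norm_sq_eq_sum (A : Matrix m n ℂ) : ‖A‖ ^ 2 = ∑ i, ∑ j, ‖A i j‖ ^ 2 := by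
  rw [Matrix.frobenius_norm_def, ← Real.sqrt_eq_rpow, Real.sq_sqrt]
  · simp
  · positivity

lemma frobenius_norm_sq (A : Matrix m n ℂ) : ‖A‖ ^ 2 = (Aᴴ * A).trace.re := by
  rw [frobenius_norm_sq_eq_sum, Finset.sum_comm]
  simp only [Matrix.trace, Matrix.diag_apply, Matrix.mul_apply, Matrix.conjTranspose_apply,
    Complex.re_sum, RCLike.star_def]
  refine Finset.sum_congr rfl fun j _ => Finset.sum_congr rfl fun i _ => ?_
  rw [mul_comm, Complex.mul_conj, Complex.ofReal_re, Complex.normSq_eq_norm_sq]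

lemma frobenius_norm_sq' (A : Matrix m n ℂ) : ‖A‖ ^ 2 = (A * Aᴴ).trace.re := by
  rw [frobenius_norm_sq, Matrix.trace_mul_comm]

lemma re_trace_conjTranspose (A : Matrix m m ℂ) : Aᴴ.trace.re = A.trace.re := by
  rw [Matrix.trace_conjTranspose]; simp

/-- Cauchy–Schwarz for the Frobenius inner product. -/
lemma abs_re_trace_mul_le (A : Matrix m n ℂ) (B : Matrix n m ℂ) :
    |(A * B).trace.re| ≤ ‖A‖ * ‖B‖ := by
  -- The quadratic is `‖Aᴴ + t B‖²`, so its discriminant is nonpositive.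
  have key : ∀ t : ℝ, 0 ≤ ‖B‖ ^ 2 * (t * t) + 2 * (A * B).trace.re * t + ‖A‖ ^ 2 := by
    intro t
    have h := sq_nonneg ‖Aᴴ + (t : ℂ) • B‖
    rw [frobenius_norm_sq] at h
    have e : (B.conjTranspose * Aᴴ).trace.re = (A * B).trace.re := by
      rw [← Matrix.conjTranspose_mul, re_trace_conjTranspose]
    simp only [Matrix.conjTranspose_add, Matrix.conjTranspose_conjTranspose,
      Matrix.conjTranspose_smul, Matrix.add_mul, Matrix.mul_add, Matrix.trace_add, Complex.add_re,
      Matrix.smul_mul, Matrix.mul_smul, Matrix.trace_smul, smul_eq_mul, RCLike.star_def,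
      Complex.conj_ofReal, Complex.re_ofReal_mul, e, ← frobenius_norm_sq,
      ← frobenius_norm_sq'] at h
    linarith
  have := discrim_le_zero key
  rw [discrim] at this
  have hsq : (A * B).trace.re ^ 2 ≤ (‖A‖ * ‖B‖) ^ 2 := by
    linarith [mul_pow ‖A‖ ‖B‖ 2, mul_pow 2 (A * B).trace.re 2]
  exact abs_le_of_sq_le_sq hsq (by positivity)

lemma norm_conjTranspose_mul_self_le (A : Matrix m n ℂ) : ‖Aᴴ * A‖ ≤ ‖A‖ ^ 2 := by
  have := Matrix.frobenius_norm_mul Aᴴ A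
  rwa [Matrix.frobenius_norm_conjTranspose, ← sq] at this

lemma re_trace_mul_mul_conjTranspose_nonneg {A : Matrix n n ℂ} (hA : A.PosSemidef)
    (C : Matrix n m ℂ) : 0 ≤ (A * (C * Cᴴ)).trace.re := by
  rw [← Matrix.mul_assoc, Matrix.trace_mul_comm, ← Matrix.mul_assoc]
  exact (Complex.le_def.1 (hA.conjTranspose_mul_mul_same C).trace_nonneg).1

/-- A kernel vector `v` satisfies `(C - 1) v = -v`; taken as a one-column matrix it must vanish by
submultiplicativity. -/
lemma isUnit_of_norm_sub_one_lt_one [DecidableEq n] {C : Matrix n n ℂ} (h : ‖C - 1‖ < 1) :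
    IsUnit C := by
  rw [← Matrix.mulVec_injective_iff_isUnit]
  refine (injective_iff_map_eq_zero C.mulVecLin).2 fun v hv => ?_
  rw [Matrix.mulVecLin_apply] at hv
  have e : (C - 1) * Matrix.replicateCol Unit v = -Matrix.replicateCol Unit v := by
    rw [← Matrix.replicateCol_mulVec, Matrix.sub_mulVec, hv, Matrix.one_mulVec, zero_sub]
    rfl
  have h1 := Matrix.frobenius_norm_mul (C - 1) (Matrix.replicateCol Unit v)
  rw [e, norm_neg] at h1
  have h0 : ‖Matrix.replicateCol Unit v‖ = 0 := by
    nlinarith [norm_nonneg (Matrix.replicateCol Unit v)]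
  simpa using h0

/-- The unitary polar factor of `B` is at distance at most `‖B * Bᴴ - 1‖` from `B`. -/
lemma exists_isometry_norm_sub_le [DecidableEq n] {B : Matrix n n ℂ} (h : ‖B * Bᴴ - 1‖ < 1) :
    ∃ W : Matrix n n ℂ, Wᴴ * W = 1 ∧ ‖B - W‖ ≤ ‖B * Bᴴ - 1‖ := by
  open scoped MatrixOrder in
  have hB := Matrix.posSemidef_self_mul_conjTranspose B
  set R := CFC.sqrt (B * Bᴴ) with hR
  have hRR : R * R = B * Bᴴ := CFC.sqrt_mul_sqrt_self _ hB.nonneg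
  have hRp : R.PosSemidef := Matrix.nonneg_iff_posSemidef.1 (CFC.sqrt_nonneg _)
  have hRh : Rᴴ = R := hRp.isHermitian
  have hRu : IsUnit R := by
    have := isUnit_of_norm_sub_one_lt_one h
    rw [← hRR] at this
    exact isUnit_of_mul_isUnit_left this
  have hdet := (Matrix.isUnit_iff_isUnit_det R).1 hRu
  have hW : (R⁻¹ * B) * (R⁻¹ * B)ᴴ = 1 := by
    rw [Matrix.conjTranspose_mul, Matrix.conjTranspose_nonsing_inv, hRh, Matrix.mul_assoc,
      ← Matrix.mul_assoc B, ← hRR, Matrix.mul_assoc, Matrix.mul_nonsing_inv _ hdet,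
      Matrix.mul_one, Matrix.nonsing_inv_mul _ hdet]
  refine ⟨R⁻¹ * B, mul_eq_one_comm.1 hW, ?_⟩
  have e1 : B - R⁻¹ * B = (R - 1) * (R⁻¹ * B) := by
    rw [Matrix.sub_mul, ← Matrix.mul_assoc, Matrix.mul_nonsing_inv _ hdet, Matrix.one_mul,
      Matrix.one_mul]
  have e2 : ‖B - R⁻¹ * B‖ ^ 2 = ‖R - 1‖ ^ 2 := by
    rw [e1, frobenius_norm_sq', frobenius_norm_sq', Matrix.conjTranspose_mul, Matrix.mul_assoc,
      ← Matrix.mul_assoc (R⁻¹ * B), hW, Matrix.one_mul]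
  -- Expand `R² - 1 = (R - 1) + R (R - 1)`; the cross term is nonnegative because `R` is, hence `‖R
  -- - 1‖ ≤ ‖R² - 1‖`.
  have e3 : ‖R * R - 1‖ ^ 2 = ‖R - 1‖ ^ 2 + 2 * (R * ((R - 1) * (R - 1)ᴴ)).trace.re
      + ‖R * (R - 1)‖ ^ 2 := by
    rw [frobenius_norm_sq, frobenius_norm_sq, frobenius_norm_sq, two_mul, ← Complex.add_re,
      ← Matrix.trace_add, ← Complex.add_re, ← Complex.add_re, ← Matrix.trace_add,
      ← Matrix.trace_add]
    simp only [Matrix.conjTranspose_sub, Matrix.conjTranspose_mul, hRh,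
      Matrix.conjTranspose_one]
    congr 2
    noncomm_ring
  have := re_trace_mul_mul_conjTranspose_nonneg hRp (R - 1)
  rw [← hRR]
  refine abs_le_of_sq_le_sq ?_ (norm_nonneg _) |> (le_abs_self _).trans
  nlinarith [sq_nonneg ‖R * (R - 1)‖]

end Frobenius

/-! ### Orthogonal projectors. -/

/-- The matrices of orthogonal projections. -/
structure IsProjector {n : Type*} [Fintype n] (P : Matrix n n ℂ) : Prop where
  herm : Pᴴ = P
  idem : P * P = P

namespace IsProjector

variable {n : Type*} [Fintype n] {P Q : Matrix n n ℂ}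

lemma posSemidef (hP : IsProjector P) : P.PosSemidef := by
  have := Matrix.posSemidef_conjTranspose_mul_self P
  rwa [hP.herm, hP.idem] at this

lemma one_sub [DecidableEq n] (hP : IsProjector P) : IsProjector (1 - P) where
  herm := by simp [hP.herm]
  idem := by simp [Matrix.mul_sub, Matrix.sub_mul, hP.idem]

lemma norm_mul_sq (hP : IsProjector P) {m : Type*} [Fintype m] (B : Matrix n m ℂ) :
    ‖P * B‖ ^ 2 = (P * (B * Bᴴ)).trace.re := by
  rw [frobenius_norm_sq, Matrix.conjTranspose_mul, hP.herm, Matrix.trace_mul_comm,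
    ← Matrix.mul_assoc, Matrix.trace_mul_comm, ← Matrix.mul_assoc, ← Matrix.mul_assoc, hP.idem,
    Matrix.mul_assoc]

lemma norm_sub_sq (hP : IsProjector P) (hQ : IsProjector Q) :
    ‖P - Q‖ ^ 2 = P.trace.re + Q.trace.re - 2 * (P * Q).trace.re := by
  rw [frobenius_norm_sq]
  simp only [Matrix.conjTranspose_sub, hP.herm, hQ.herm, Matrix.sub_mul, Matrix.mul_sub,
    hP.idem, hQ.idem, Matrix.trace_sub, Complex.sub_re, Matrix.trace_mul_comm Q P]
  ring

end IsProjector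

/-- The projector built from an isometry. -/
lemma isProjector_mul_conjTranspose {m n : Type*} [Fintype m] [Fintype n] [DecidableEq m]
    {V : Matrix n m ℂ} (hV : Vᴴ * V = 1) : IsProjector (V * Vᴴ) where
  herm := by simp
  idem := by rw [Matrix.mul_assoc, ← Matrix.mul_assoc Vᴴ, hV, Matrix.one_mul]

/-- The trace is only bounded by `m`, since `X` may be rank deficient: full rank of the minimizers
is proved later. -/
lemma exists_projector_range {N m : ℕ} (X : Matrix (Fin N) (Fin m) ℂ) :
    ∃ P : Matrix (Fin N) (Fin N) ℂ, IsProjector P ∧ P * X = X ∧ P.trace.re ≤ m := by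
  let W := LinearMap.range (Matrix.toEuclideanLin X)
  let b := stdOrthonormalBasis ℂ W
  let Y : Matrix (Fin N) (Fin (Module.finrank ℂ W)) ℂ :=
    Matrix.of fun i k => (b k : EuclideanSpace ℂ (Fin N)) i
  have hY : Yᴴ * Y = 1 := by
    ext j k
    have := orthonormal_iff_ite.1 b.orthonormal j k
    rw [Submodule.coe_inner, PiLp.inner_apply] at this
    rw [Matrix.one_apply, ← this, Matrix.mul_apply]
    refine Finset.sum_congr rfl fun i _ => ?_
    simp [Y, mul_comm]
  refine ⟨Y * Yᴴ, isProjector_mul_conjTranspose hY, ?_, ?_⟩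
  · ext i j
    have hx : Matrix.toEuclideanLin X (EuclideanSpace.single j 1) ∈ W := ⟨_, rfl⟩
    have h := b.sum_repr' ⟨_, hx⟩
    have h' := congrArg (fun w : W => (w : EuclideanSpace ℂ (Fin N)) i) h
    simp only [AddSubmonoidClass.coe_finsetSum, Submodule.coe_smul, Submodule.coe_inner] at h'
    rw [WithLp.ofLp_sum, Finset.sum_apply] at h'
    simp only [PiLp.smul_apply, smul_eq_mul, PiLp.inner_apply] at h'
    simp only [Matrix.toLpLin_apply, PiLp.ofLp_single, Matrix.mulVec_single_one,
      Matrix.col_apply] at h'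
    rw [← h', Matrix.mul_assoc, Matrix.mul_apply]
    refine Finset.sum_congr rfl fun k _ => ?_
    rw [mul_comm, Matrix.mul_apply]
    simp [Y, mul_comm]
  · rw [Matrix.trace_mul_comm, hY, Matrix.trace_one]
    have := LinearMap.finrank_range_le (Matrix.toEuclideanLin X)
    rw [finrank_euclideanSpace_fin] at this
    simpa using this

/-! ### The entrywise `ℓ¹` norm against the Frobenius norm. -/

lemma l1norm_le {N m : ℕ} (X : Matrix (Fin N) (Fin m) ℂ) :
    l1norm X ≤ √(N : ℝ) * √(m : ℝ) * ‖X‖ := by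
  have h : l1norm X ^ 2 ≤ N * m * ‖X‖ ^ 2 := by
    rw [l1norm, frobenius_norm_sq_eq_sum, ← Fintype.sum_prod_type', ← Fintype.sum_prod_type']
    simpa using sq_sum_le_card_mul_sum_sq (s := Finset.univ)
      (f := fun x : Fin N × Fin m => ‖X x.1 x.2‖)
  refine abs_le_of_sq_le_sq (h.trans_eq ?_) (by positivity) |> (le_abs_self _).trans
  rw [mul_pow, mul_pow, Real.sq_sqrt (by positivity), Real.sq_sqrt (by positivity)]

lemma l1norm_nonneg {N m : ℕ} (X : Matrix (Fin N) (Fin m) ℂ) : 0 ≤ l1norm X := by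
  unfold l1norm; positivity

lemma l1norm_sub_le {N m : ℕ} (X Y : Matrix (Fin N) (Fin m) ℂ) :
    l1norm X - l1norm Y ≤ l1norm (Y - X) := by
  simp only [l1norm, ← Finset.sum_sub_distrib]
  refine Finset.sum_le_sum fun i _ => Finset.sum_le_sum fun j _ => ?_
  rw [Matrix.sub_apply, norm_sub_rev]
  exact norm_sub_norm_le _ _

end OMM

/-! ### Quadratic growth of the unpenalized energy. -/

namespace OMM

/-- `P₀` is a projector of trace `m` that reduces `-H`, with `-H ≥ a` on its range and
`0 ≤ -H ≤ b` on the orthogonal complement, where `0 ≤ b < a`. -/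
structure SpectralGap {n : Type*} [Fintype n] [DecidableEq n] (H P₀ : Matrix n n ℂ) (m : ℕ)
    (a b : ℝ) : Prop where
  proj : IsProjector P₀
  trace_re : P₀.trace.re = m
  lower : (-H * P₀ - (a : ℂ) • P₀).PosSemidef
  upper : ((b : ℂ) • (1 - P₀) + H * (1 - P₀)).PosSemidef
  ge : (-H - (a : ℂ) • P₀).PosSemidef
  nonneg : 0 ≤ b
  lt : b < a

lemma IsProjector.re_trace_mul_nonneg {n : Type*} [Fintype n] {A P : Matrix n n ℂ}
    (hP : IsProjector P) (hA : A.PosSemidef) : 0 ≤ (A * P).trace.re := by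
  have := re_trace_mul_mul_conjTranspose_nonneg hA P
  rwa [hP.herm, hP.idem] at this

variable {N m : ℕ} {H P₀ P : Matrix (Fin N) (Fin N) ℂ} {X V : Matrix (Fin N) (Fin m) ℂ} {a b : ℝ}

/-- The energy is `tr H (2 X Xᴴ - (X Xᴴ)²)`, and `P * X = X` gives `(P - X Xᴴ)² = P - 2 X Xᴴ + (X
Xᴴ)²`. -/
lemma E0_eq (hP : IsProjector P) (hPX : P * X = X) :
    E0 H X = (H * P).trace.re - (H * ((P - X * Xᴴ) * (P - X * Xᴴ)ᴴ)).trace.re := by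
  have h1 : P * (X * Xᴴ) = X * Xᴴ := by rw [← Matrix.mul_assoc, hPX]
  have h2 : X * Xᴴ * P = X * Xᴴ := by
    have := congrArg Matrix.conjTranspose h1
    simpa [Matrix.conjTranspose_mul, hP.herm, Matrix.mul_assoc] using this
  have h3 : (P - X * Xᴴ) * (P - X * Xᴴ)ᴴ = P - (2 : ℂ) • (X * Xᴴ) + X * Xᴴ * (X * Xᴴ) := by
    simp only [Matrix.conjTranspose_sub, hP.herm, Matrix.conjTranspose_mul,
      Matrix.conjTranspose_conjTranspose, Matrix.sub_mul, Matrix.mul_sub, hP.idem, h1, h2,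
      two_smul]
    abel
  rw [h3, E0, ← Complex.sub_re, ← Matrix.trace_sub, Matrix.sub_mul, Matrix.trace_sub,
    Matrix.smul_mul, Matrix.one_mul, Matrix.trace_smul, Matrix.mul_add, Matrix.mul_sub,
    Matrix.mul_smul]
  have e1 : (Xᴴ * H * X).trace = (H * (X * Xᴴ)).trace := by
    rw [Matrix.mul_assoc, Matrix.trace_mul_comm, Matrix.mul_assoc]
  have e2 : (Xᴴ * X * (Xᴴ * H * X)).trace = (H * (X * Xᴴ * (X * Xᴴ))).trace := by
    rw [Matrix.trace_mul_comm, Matrix.mul_assoc Xᴴ, Matrix.mul_assoc Xᴴ, Matrix.trace_mul_comm]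
    simp only [Matrix.mul_assoc]
  rw [e1, e2]
  simp only [Matrix.trace_add, Matrix.trace_sub, Matrix.trace_smul]
  congr 1
  ring

namespace SpectralGap

variable (h : SpectralGap H P₀ m a b)
include h

/-- Test `lower` against `1 - P` and `upper` against `P`, then add: the mixed terms `tr (H P₀ P)`
cancel. A trace deficit `m - tr P` only helps, as `a + b ≥ 0`. -/
lemma re_trace_sub_ge (hP : IsProjector P) (hr : P.trace.re ≤ m) :
    (a - b) / 2 * ‖P - P₀‖ ^ 2 ≤ (H * P).trace.re - (H * P₀).trace.re := by
  have h1 := hP.one_sub.re_trace_mul_nonneg h.lower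
  have h2 := hP.re_trace_mul_nonneg h.upper
  have ht := h.trace_re
  rw [hP.norm_sub_sq h.proj, ht]
  rw [Matrix.trace_mul_comm P P₀]
  simp only [Matrix.sub_mul, Matrix.mul_sub, Matrix.add_mul, Matrix.mul_one, Matrix.one_mul,
    Matrix.smul_mul, Matrix.trace_add, Matrix.trace_sub, Matrix.trace_smul, Matrix.neg_mul,
    Matrix.trace_neg, Complex.add_re, Complex.sub_re, Complex.neg_re, smul_eq_mul,
    Complex.re_ofReal_mul, smul_sub] at h1 h2
  have := h.nonneg
  have := h.lt
  rw [ht] at h1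
  nlinarith

/-- The leakage of the range of `P` out of the range of `P₀`. -/
lemma norm_one_sub_mul_sq_le (hP : IsProjector P) (hr : P.trace.re ≤ m) :
    ‖(1 - P₀) * P‖ ^ 2 ≤ ‖P - P₀‖ ^ 2 / 2 := by
  rw [h.proj.one_sub.norm_mul_sq, hP.herm, hP.idem, hP.norm_sub_sq h.proj, h.trace_re,
    Matrix.sub_mul, Matrix.one_mul, Matrix.trace_sub, Complex.sub_re, Matrix.trace_mul_comm P]
  linarith

lemma growth (hP : IsProjector P) (hr : P.trace.re ≤ m) (hPX : P * X = X)
    (hVP : V * Vᴴ = P₀) (hPV : P₀ * V = V) :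
    (a - b) / 2 * ‖P - P₀‖ ^ 2 + a * ‖P₀ * (P - X * Xᴴ)‖ ^ 2 ≤ E0 H X - E0 H V := by
  rw [E0_eq hP hPX, E0_eq h.proj hPV, hVP, sub_self, Matrix.zero_mul, Matrix.mul_zero,
    Matrix.trace_zero, Complex.zero_re, sub_zero]
  have h1 := h.re_trace_sub_ge hP hr
  have h2 := re_trace_mul_mul_conjTranspose_nonneg h.ge (P - X * Xᴴ)
  rw [Matrix.sub_mul, Matrix.smul_mul, Matrix.trace_sub, Matrix.trace_smul, smul_eq_mul,
    Complex.sub_re, Complex.re_ofReal_mul, ← h.proj.norm_mul_sq, Matrix.neg_mul,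
    Matrix.trace_neg, Complex.neg_re] at h2
  linarith

/-- Since `K = P K`, the part of `K` outside the range of `P₀` is at most the leakage of `P` times
`‖K‖`, so `‖P₀ K‖²` in `growth` keeps most of `‖K‖²`. -/
lemma quadratic_growth (hP : IsProjector P) (hr : P.trace.re ≤ m) (hPX : P * X = X)
    (hVP : V * Vᴴ = P₀) (hPV : P₀ * V = V) :
    (a - b) / 2 * ‖P - P₀‖ ^ 2 + a * (1 - ‖P - P₀‖ ^ 2 / 2) * ‖P - X * Xᴴ‖ ^ 2
      ≤ E0 H X - E0 H V := by
  refine le_trans ?_ (h.growth hP hr hPX hVP hPV)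
  set K := P - X * Xᴴ with hK
  have hPK : P * K = K := by
    rw [hK, Matrix.mul_sub, ← Matrix.mul_assoc, hPX, hP.idem]
  have h3 : ‖K‖ ^ 2 = ‖P₀ * K‖ ^ 2 + ‖(1 - P₀) * K‖ ^ 2 := by
    rw [h.proj.norm_mul_sq, h.proj.one_sub.norm_mul_sq, ← Complex.add_re, ← Matrix.trace_add,
      ← Matrix.add_mul, add_sub_cancel, Matrix.one_mul, frobenius_norm_sq']
  have h4 : ‖(1 - P₀) * K‖ ^ 2 ≤ ‖P - P₀‖ ^ 2 / 2 * ‖K‖ ^ 2 := by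
    have h5 : ‖(1 - P₀) * K‖ ≤ ‖(1 - P₀) * P‖ * ‖K‖ := by
      conv_lhs => rw [← hPK, ← Matrix.mul_assoc]
      exact Matrix.frobenius_norm_mul _ _
    calc _ ≤ (‖(1 - P₀) * P‖ * ‖K‖) ^ 2 := by gcongr
      _ = ‖(1 - P₀) * P‖ ^ 2 * ‖K‖ ^ 2 := mul_pow _ _ _
      _ ≤ _ := by gcongr; exact h.norm_one_sub_mul_sq_le hP hr
  have ha : 0 ≤ a := h.nonneg.trans h.lt.le
  nlinarith [mul_le_mul_of_nonneg_left h4 ha]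

/-- A plain triangle inequality would lose a factor 2. Here the cross term of `(P - P₀) - K` equals
`tr (K Lᴴ L)` with `L = (1 - P₀) P`, which is of third order, so the constant tends to 1 with `‖K‖`.
-/
lemma norm_sub_sq_le (hP : IsProjector P) (hr : P.trace.re ≤ m) (hPX : P * X = X) :
    ‖X * Xᴴ - P₀‖ ^ 2 ≤
      (1 + ‖P - X * Xᴴ‖) * (‖P - P₀‖ ^ 2 + ‖P - X * Xᴴ‖ ^ 2) := by
  have h1 : P * (X * Xᴴ) = X * Xᴴ := by rw [← Matrix.mul_assoc, hPX]
  have h2 : X * Xᴴ * P = X * Xᴴ := by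
    have := congrArg Matrix.conjTranspose h1
    simpa [Matrix.conjTranspose_mul, hP.herm, Matrix.mul_assoc] using this
  set K := P - X * Xᴴ with hK
  have hPK : P * K = K := by rw [hK, Matrix.mul_sub, h1, hP.idem]
  have hKP : K * P = K := by rw [hK, Matrix.sub_mul, h2, hP.idem]
  have hKh : Kᴴ = K := by simp [hK, hP.herm]
  have e : X * Xᴴ - P₀ = (P - P₀) - K := by rw [hK]; abel
  set L := (1 - P₀) * P with hL
  have hLL : Lᴴ * L = P * (P - P₀) * P := by
    rw [hL, Matrix.conjTranspose_mul, hP.herm, h.proj.one_sub.herm, Matrix.mul_assoc,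
      ← Matrix.mul_assoc (1 - P₀), h.proj.one_sub.idem, ← Matrix.mul_assoc]
    simp only [Matrix.mul_sub, Matrix.sub_mul, hP.idem, Matrix.mul_one]
  have e1 : ‖X * Xᴴ - P₀‖ ^ 2 = ‖P - P₀‖ ^ 2 + ‖K‖ ^ 2 - 2 * (K * (Lᴴ * L)).trace.re := by
    have e2 : (K * (Lᴴ * L)).trace = (K * (P - P₀)).trace := by
      rw [hLL, ← Matrix.mul_assoc, Matrix.trace_mul_comm, ← Matrix.mul_assoc, ← Matrix.mul_assoc,
        hPK, hKP]
    rw [e2, e, frobenius_norm_sq, frobenius_norm_sq, frobenius_norm_sq]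
    simp only [Matrix.conjTranspose_sub, hP.herm, h.proj.herm, hKh, Matrix.sub_mul,
      Matrix.mul_sub, Matrix.trace_sub, Complex.sub_re, Matrix.trace_mul_comm P K,
      Matrix.trace_mul_comm P₀ K]
    ring
  have h3 := (abs_le.1 (abs_re_trace_mul_le K (Lᴴ * L))).1
  have h4 := norm_conjTranspose_mul_self_le L
  have h5 := mul_le_mul_of_nonneg_left (h4.trans (h.norm_one_sub_mul_sq_le hP hr)) (norm_nonneg K)
  rw [e1]
  nlinarith [pow_nonneg (norm_nonneg K) 3]

/-- The minimizers of the unpenalized functional near `X`. -/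
lemma exists_isometry_near (hVV : Vᴴ * V = 1) (hVP : V * Vᴴ = P₀)
    (hD : ‖X * Xᴴ - P₀‖ ≤ 1 / 2) :
    ∃ W : Matrix (Fin m) (Fin m) ℂ, Wᴴ * W = 1 ∧ ‖X - V * W‖ ≤ ‖X * Xᴴ - P₀‖ := by
  set D := X * Xᴴ - P₀ with hDdef
  set B := Vᴴ * X with hB
  set C := (1 - P₀) * X with hC
  have hDh : Dᴴ = D := by simp [hDdef, h.proj.herm]
  have hVn : ∀ {k : Type} [Fintype k] (Y : Matrix (Fin m) k ℂ), ‖V * Y‖ ^ 2 = ‖Y‖ ^ 2 := by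
    intro k _ Y
    rw [frobenius_norm_sq, frobenius_norm_sq, Matrix.conjTranspose_mul, Matrix.mul_assoc,
      ← Matrix.mul_assoc Vᴴ, hVV, Matrix.one_mul]
  have hsplit : ∀ {k : Type} [Fintype k] (Y : Matrix (Fin N) k ℂ),
      ‖Y‖ ^ 2 = ‖Vᴴ * Y‖ ^ 2 + ‖(1 - P₀) * Y‖ ^ 2 := by
    intro k _ Y
    rw [← hVn, ← Matrix.mul_assoc, hVP, h.proj.norm_mul_sq, h.proj.one_sub.norm_mul_sq,
      ← Complex.add_re, ← Matrix.trace_add, ← Matrix.add_mul, add_sub_cancel, Matrix.one_mul,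
      frobenius_norm_sq']
  have hQP : (1 - P₀) * P₀ = 0 := by rw [Matrix.sub_mul, h.proj.idem, Matrix.one_mul, sub_self]
  have hQV : (1 - P₀) * V = 0 := by
    rw [← hVP, Matrix.sub_mul, Matrix.mul_assoc, hVV, Matrix.one_mul, Matrix.mul_one, sub_self]
  have hPV : P₀ * V = V := by rw [← hVP, Matrix.mul_assoc, hVV, Matrix.mul_one]
  have hBB : Vᴴ * D * V = B * Bᴴ - 1 := by
    rw [hDdef, Matrix.mul_sub, Matrix.sub_mul, Matrix.mul_assoc Vᴴ P₀, hPV, hVV, hB]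
    simp only [Matrix.conjTranspose_mul, Matrix.conjTranspose_conjTranspose, Matrix.mul_assoc]
  have hCB : (1 - P₀) * (D * V) = C * Bᴴ := by
    rw [hDdef, Matrix.sub_mul (X * Xᴴ), Matrix.mul_sub, ← Matrix.mul_assoc _ P₀, hQP,
      Matrix.zero_mul, sub_zero, hC, hB]
    simp only [Matrix.conjTranspose_mul, Matrix.conjTranspose_conjTranspose, Matrix.mul_assoc]
  have hDV : ‖D * V‖ ^ 2 = ‖B * Bᴴ - 1‖ ^ 2 + ‖C * Bᴴ‖ ^ 2 := by
    rw [hsplit (D * V), hCB, ← hBB, Matrix.mul_assoc Vᴴ]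
  -- In blocks along `P₀`, `D` has diagonal block `B Bᴴ - 1` and two off-diagonal blocks of norm `‖C
  -- Bᴴ‖`. This double count pays for the factor 2 in `hCle`.
  have hDsum : ‖B * Bᴴ - 1‖ ^ 2 + 2 * ‖C * Bᴴ‖ ^ 2 ≤ ‖D‖ ^ 2 := by
    have h2 : ‖C * Bᴴ‖ ^ 2 = ‖Vᴴ * (D * (1 - P₀))‖ ^ 2 := by
      rw [← Matrix.frobenius_norm_conjTranspose, ← hCB, Matrix.conjTranspose_mul,
        Matrix.conjTranspose_mul, hDh, h.proj.one_sub.herm, Matrix.mul_assoc]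
    have h3 : ‖D‖ ^ 2 = ‖D * V‖ ^ 2 + ‖D * (1 - P₀)‖ ^ 2 := by
      rw [hsplit D, ← Matrix.frobenius_norm_conjTranspose, Matrix.conjTranspose_mul, hDh,
        ← Matrix.frobenius_norm_conjTranspose ((1 - P₀) * D), Matrix.conjTranspose_mul, hDh,
        Matrix.conjTranspose_conjTranspose, h.proj.one_sub.herm]
    rw [h3, hDV, hsplit (D * (1 - P₀)), ← h2]
    nlinarith [sq_nonneg ‖(1 - P₀) * (D * (1 - P₀))‖]
  have hu : ‖B * Bᴴ - 1‖ ≤ 1 / 2 := by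
    refine (abs_le_of_sq_le_sq ?_ (norm_nonneg D) |> (le_abs_self _).trans).trans hD
    nlinarith [sq_nonneg ‖C * Bᴴ‖]
  have hu' : ‖Bᴴ * B - 1‖ ^ 2 = ‖B * Bᴴ - 1‖ ^ 2 := by
    rw [frobenius_norm_sq, frobenius_norm_sq]
    have e : (Bᴴ * B * (Bᴴ * B)).trace = (B * Bᴴ * (B * Bᴴ)).trace := by
      rw [Matrix.mul_assoc, Matrix.trace_mul_comm]
      simp only [Matrix.mul_assoc]
    simp only [Matrix.conjTranspose_sub, Matrix.conjTranspose_mul,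
      Matrix.conjTranspose_conjTranspose, Matrix.conjTranspose_one, Matrix.sub_mul,
      Matrix.mul_sub, Matrix.trace_sub, e, Matrix.one_mul, Matrix.mul_one,
      Matrix.trace_mul_comm Bᴴ B]
  -- `Bᴴ B` is within `1 / 2` of the identity, so multiplying by `Bᴴ` at most halves `‖C‖²`.
  have hCle : ‖C‖ ^ 2 ≤ 2 * ‖C * Bᴴ‖ ^ 2 := by
    have e : ‖C * Bᴴ‖ ^ 2 = ‖C‖ ^ 2 + (Cᴴ * C * (Bᴴ * B - 1)).trace.re := by
      rw [frobenius_norm_sq, frobenius_norm_sq, ← Complex.add_re, ← Matrix.trace_add,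
        Matrix.mul_sub, Matrix.mul_one, add_sub_cancel, Matrix.conjTranspose_mul,
        Matrix.conjTranspose_conjTranspose, Matrix.mul_assoc, Matrix.trace_mul_comm]
      simp only [Matrix.mul_assoc]
    have h1 := (abs_le.1 (abs_re_trace_mul_le (Cᴴ * C) (Bᴴ * B - 1))).1
    have h2 := norm_conjTranspose_mul_self_le C
    have h3 : ‖Bᴴ * B - 1‖ ≤ 1 / 2 := by
      refine (abs_le_of_sq_le_sq ?_ (norm_nonneg (B * Bᴴ - 1)) |> (le_abs_self _).trans).trans hu
      exact hu'.le
    have h4 := mul_le_mul h2 h3 (norm_nonneg _) (sq_nonneg _)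
    linarith
  -- `W` is the polar factor of `B`, and `‖X - V W‖² = ‖B - W‖² + ‖C‖²`.
  obtain ⟨W, hW, hBW⟩ := exists_isometry_norm_sub_le (hu.trans_lt (by norm_num))
  refine ⟨W, hW, abs_le_of_sq_le_sq ?_ (norm_nonneg D) |> (le_abs_self _).trans⟩
  rw [hsplit (X - V * W), Matrix.mul_sub, Matrix.mul_sub, ← Matrix.mul_assoc, ← Matrix.mul_assoc,
    hVV, hQV, Matrix.one_mul, Matrix.zero_mul, sub_zero]
  have := pow_le_pow_left₀ (norm_nonneg _) hBW 2
  linarith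

end SpectralGap

end OMM

/-! ### Minimizers of the penalized functional. -/

namespace OMM

variable {N m : ℕ} {H P₀ : Matrix (Fin N) (Fin N) ℂ} {X V : Matrix (Fin N) (Fin m) ℂ} {a b : ℝ}

/-- If `Xᴴ V v = 0`, then `X Xᴴ - V Vᴴ` sends `V v` to `-V v`, which forces `v = 0`. So the square
matrix `Xᴴ V` is invertible and `X` is injective. -/
lemma isUnit_conjTranspose_mul_self (hVV : Vᴴ * V = 1) (hD : ‖X * Xᴴ - V * Vᴴ‖ < 1) :
    IsUnit (Xᴴ * X) := by
  have hinj : ∀ v, Xᴴ *ᵥ (V *ᵥ v) = 0 → v = 0 := by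
    intro v hv
    have e : (X * Xᴴ - V * Vᴴ) * (V * Matrix.replicateCol Unit v)
        = -(V * Matrix.replicateCol Unit v) := by
      have h1 : X * Xᴴ * (V * Matrix.replicateCol Unit v) = 0 := by
        rw [← Matrix.replicateCol_mulVec, ← Matrix.replicateCol_mulVec, ← Matrix.mulVec_mulVec,
          hv, Matrix.mulVec_zero]
        rfl
      rw [Matrix.sub_mul, h1, Matrix.mul_assoc V, ← Matrix.mul_assoc Vᴴ, hVV, Matrix.one_mul,
        zero_sub]
    have h1 := Matrix.frobenius_norm_mul (X * Xᴴ - V * Vᴴ) (V * Matrix.replicateCol Unit v)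
    rw [e, norm_neg] at h1
    have h0 : V * Matrix.replicateCol Unit v = 0 := by
      rw [← norm_eq_zero]
      nlinarith [norm_nonneg (V * Matrix.replicateCol Unit v)]
    have h2 : Vᴴ * (V * Matrix.replicateCol Unit v) = 0 := by rw [h0, Matrix.mul_zero]
    rw [← Matrix.mul_assoc, hVV, Matrix.one_mul] at h2
    simpa using h2
  have hB : IsUnit (Xᴴ * V) := by
    rw [← Matrix.mulVec_injective_iff_isUnit]
    refine (injective_iff_map_eq_zero (Xᴴ * V).mulVecLin).2 fun v hv => hinj v ?_
    rwa [Matrix.mulVecLin_apply, ← Matrix.mulVec_mulVec] at hv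
  have hB' : IsUnit (Vᴴ * X) := by
    have := (Matrix.isUnit_conjTranspose (A := Xᴴ * V)).2 hB
    simpa using this
  rw [← Matrix.mulVec_injective_iff_isUnit] at hB' ⊢
  refine (injective_iff_map_eq_zero (Xᴴ * X).mulVecLin).2 fun v hv => ?_
  rw [Matrix.mulVecLin_apply, Matrix.conjTranspose_mul_self_mulVec_eq_zero] at hv
  apply hB'
  rw [← Matrix.mulVec_mulVec, hv, Matrix.mulVec_zero, Matrix.mulVec_zero]

lemma isProjector_P (hX : IsUnit (Xᴴ * X)) : IsProjector (P X) where
  herm := by simp [P, Matrix.conjTranspose_nonsing_inv, Matrix.mul_assoc]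
  idem := by
    have hdet := (Matrix.isUnit_iff_isUnit_det _).1 hX
    calc P X * P X = X * ((Xᴴ * X)⁻¹ * (Xᴴ * X)) * (Xᴴ * X)⁻¹ * Xᴴ := by
          simp only [P, Matrix.mul_assoc]
      _ = P X := by rw [Matrix.nonsing_inv_mul _ hdet, Matrix.mul_one, P]

lemma P_mul_self (hX : IsUnit (Xᴴ * X)) : P X * X = X := by
  rw [P, Matrix.mul_assoc, Matrix.mul_assoc,
    Matrix.nonsing_inv_mul _ ((Matrix.isUnit_iff_isUnit_det _).1 hX), Matrix.mul_one]

lemma trace_P (hX : IsUnit (Xᴴ * X)) : (P X).trace.re = m := by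
  rw [P, Matrix.mul_assoc, Matrix.trace_mul_comm, Matrix.mul_assoc,
    Matrix.nonsing_inv_mul _ ((Matrix.isUnit_iff_isUnit_det _).1 hX), Matrix.trace_one]
  simp

/-- Among the projectors of rank `m`, the one onto the column space of `X` is closest to
`X * Xᴴ`. -/
lemma norm_P_sub_le (hX : IsUnit (Xᴴ * X)) {Q : Matrix (Fin N) (Fin N) ℂ} (hQ : IsProjector Q)
    (ht : Q.trace.re = m) : ‖P X - X * Xᴴ‖ ≤ ‖X * Xᴴ - Q‖ := by
  -- For projectors of trace `m` the distance to `X Xᴴ` depends only on `‖R X‖`, which is largest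
  -- when `R X = X`.
  have key : ∀ {R : Matrix (Fin N) (Fin N) ℂ}, IsProjector R → R.trace.re = m →
      ‖X * Xᴴ - R‖ ^ 2 = ‖X * Xᴴ‖ ^ 2 + m - 2 * ‖R * X‖ ^ 2 := by
    intro R hR hRt
    rw [hR.norm_mul_sq, frobenius_norm_sq, frobenius_norm_sq, ← hRt]
    simp only [Matrix.conjTranspose_sub, Matrix.conjTranspose_mul,
      Matrix.conjTranspose_conjTranspose, hR.herm, Matrix.sub_mul, Matrix.mul_sub, hR.idem,
      Matrix.trace_sub, Complex.sub_re, Matrix.trace_mul_comm _ R]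
    ring
  rw [norm_sub_rev]
  refine abs_le_of_sq_le_sq ?_ (norm_nonneg _) |> (le_abs_self _).trans
  rw [key hQ ht, key (isProjector_P hX) (trace_P hX), P_mul_self hX]
  have : ‖X‖ ^ 2 = ‖Q * X‖ ^ 2 + ‖(1 - Q) * X‖ ^ 2 := by
    rw [hQ.norm_mul_sq, hQ.one_sub.norm_mul_sq, ← Complex.add_re, ← Matrix.trace_add,
      ← Matrix.add_mul, add_sub_cancel, Matrix.one_mul, frobenius_norm_sq']
  nlinarith [sq_nonneg ‖(1 - Q) * X‖]

lemma E0_sub_le_of_mem_S {μ : ℝ} (hX : X ∈ S H m μ) (Y : Matrix (Fin N) (Fin m) ℂ) :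
    E0 H X - E0 H Y ≤ μ * (l1norm Y - l1norm X) := by
  have := hX Y
  simp only [E] at this
  linarith

lemma E0_of_mul_conjTranspose_eq (hP : IsProjector P₀) (hX : X * Xᴴ = P₀) (hPX : P₀ * X = X) :
    E0 H X = (H * P₀).trace.re := by
  rw [E0_eq hP hPX, hX, sub_self, Matrix.zero_mul, Matrix.mul_zero]
  simp

lemma E0_sub_le_of_isometry {μ : ℝ} (hVV : Vᴴ * V = 1) (hμ : 0 ≤ μ) (hX : X ∈ S H m μ) :
    E0 H X - E0 H V ≤ μ * (√(N : ℝ) * m) := by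
  have hV : ‖V‖ = √(m : ℝ) := by
    rw [← Real.sqrt_sq (norm_nonneg V), frobenius_norm_sq, hVV, Matrix.trace_one]
    simp
  have hm2 : √(m : ℝ) * √(m : ℝ) = m := Real.mul_self_sqrt (by positivity)
  refine (E0_sub_le_of_mem_S hX V).trans ?_
  gcongr
  have := l1norm_le V
  rw [hV, mul_assoc, hm2] at this
  linarith [l1norm_nonneg X]

/-- Here `p = ‖P - P₀‖`, `k = ‖P - X Xᴴ‖`, `d = ‖X Xᴴ - P₀‖`, `F` is the energy excess and `c` its
crude bound. First `hp` gives `p ≤ 1`, so the coefficient of `k²` in `hpk` is at least `a / 2 ≥ g /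
2`. -/
lemma quadratic_growth_bounds {g a p k d ε c F : ℝ} (hg : 0 < g) (ha : g ≤ a)
    (hε : 0 ≤ ε) (hε' : ε ≤ 1 / 3) (hc : 2 * c ≤ g * ε ^ 2) (hF : F ≤ c)
    (hp : g / 2 * p ^ 2 ≤ F) (hpk : g / 2 * p ^ 2 + a * (1 - p ^ 2 / 2) * k ^ 2 ≤ F)
    (hd : d ^ 2 ≤ (1 + k) * (p ^ 2 + k ^ 2)) :
    g / 2 * (p ^ 2 + k ^ 2) ≤ F ∧ k ≤ ε ∧ d ≤ 1 / 2 := by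
  have hε2 : ε ^ 2 ≤ 1 / 9 := by nlinarith
  have hp1 : p ^ 2 ≤ 1 := by
    have : p ^ 2 ≤ ε ^ 2 := le_of_mul_le_mul_left (by linarith) hg
    linarith
  have hgrow : g / 2 * (p ^ 2 + k ^ 2) ≤ F := by
    have h1 : a * (1 / 2) ≤ a * (1 - p ^ 2 / 2) := by gcongr <;> linarith
    have h2 : g / 2 ≤ a * (1 - p ^ 2 / 2) := by linarith
    have h3 := mul_le_mul_of_nonneg_right h2 (sq_nonneg k)
    linarith
  have hε3 : p ^ 2 + k ^ 2 ≤ ε ^ 2 := le_of_mul_le_mul_left (by linarith) hg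
  have hkε : k ≤ ε := abs_le_of_sq_le_sq (by linarith [sq_nonneg p]) hε |> (le_abs_self _).trans
  refine ⟨hgrow, hkε, abs_le_of_sq_le_sq ?_ (by norm_num) |> (le_abs_self _).trans⟩
  calc d ^ 2 ≤ (1 + k) * (p ^ 2 + k ^ 2) := hd
    _ ≤ (1 + 1 / 3) * (1 / 9) := by gcongr <;> linarith
    _ ≤ (1 / 2) ^ 2 := by norm_num

namespace SpectralGap

/-- Replacing `V` by the nearby `V W`, of equal energy, makes the bound on the excess linear in the
distance. -/
lemma E0_sub_le_mul_norm (h : SpectralGap H P₀ m a b) (hVV : Vᴴ * V = 1) (hVP : V * Vᴴ = P₀)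
    {μ : ℝ} (hμ : 0 ≤ μ) (hX : X ∈ S H m μ) (hd : ‖X * Xᴴ - P₀‖ ≤ 1 / 2) :
    E0 H X - E0 H V ≤ μ * m * √(N : ℝ) * ‖X * Xᴴ - P₀‖ := by
  have hPV : P₀ * V = V := by rw [← hVP, Matrix.mul_assoc, hVV, Matrix.mul_one]
  obtain ⟨W, hW, hδ⟩ := h.exists_isometry_near hVV hVP hd
  have hVW : V * W * (V * W)ᴴ = P₀ := by
    rw [Matrix.conjTranspose_mul, Matrix.mul_assoc, ← Matrix.mul_assoc W, mul_eq_one_comm.1 hW,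
      Matrix.one_mul, hVP]
  have hsm : √(m : ℝ) ≤ m := by
    rcases Nat.eq_zero_or_pos m with rfl | hm
    · simp
    · rw [Real.sqrt_le_left (by positivity)]
      have : (1 : ℝ) ≤ m := by exact_mod_cast hm
      nlinarith
  have e : E0 H V = E0 H (V * W) := by
    rw [E0_of_mul_conjTranspose_eq h.proj hVP hPV, E0_of_mul_conjTranspose_eq h.proj hVW
      (by rw [← Matrix.mul_assoc, hPV])]
  rw [e, mul_assoc, mul_assoc]
  refine (E0_sub_le_of_mem_S hX _).trans ?_
  gcongr
  calc _ ≤ _ := l1norm_sub_le _ _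
    _ ≤ _ := l1norm_le _
    _ ≤ √(N : ℝ) * m * ‖X * Xᴴ - P₀‖ := by gcongr
    _ = _ := by ring

lemma norm_sub_le_of_mem_S (h : SpectralGap H P₀ m a b) (hVV : Vᴴ * V = 1) (hVP : V * Vᴴ = P₀)
    {μ ε : ℝ} (hμ : 0 ≤ μ) (hε : 0 ≤ ε) (hε' : ε ≤ 1 / 3)
    (hμε : 2 * (μ * (√(N : ℝ) * m)) ≤ (a - b) * ε ^ 2) (hX : X ∈ S H m μ) :
    ‖X * Xᴴ - P₀‖ ≤ 1 / 2 ∧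
      (a - b) * ‖X * Xᴴ - P₀‖ ≤ 2 * μ * m * √(N : ℝ) * (1 + ε) := by
  obtain ⟨P, hP, hPX, hr⟩ := exists_projector_range X
  have hab := sub_pos.2 h.lt
  have ha : a - b ≤ a := sub_le_self _ h.nonneg
  have hPV : P₀ * V = V := by rw [← hVP, Matrix.mul_assoc, hVV, Matrix.mul_one]
  have hsub := h.norm_sub_sq_le hP hr hPX
  have hp : (a - b) / 2 * ‖P - P₀‖ ^ 2 ≤ E0 H X - E0 H V :=
    (le_add_of_nonneg_right (mul_nonneg (hab.le.trans ha) (sq_nonneg _))).trans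
      (h.growth hP hr hPX hVP hPV)
  obtain ⟨hgrow, hk, hd⟩ := quadratic_growth_bounds hab ha hε hε' hμε
    (E0_sub_le_of_isometry hVV hμ hX) hp (h.quadratic_growth hP hr hPX hVP hPV) hsub
  refine ⟨hd, ?_⟩
  have hloc := hgrow.trans (h.E0_sub_le_mul_norm hVV hVP hμ hX hd)
  generalize ‖X * Xᴴ - P₀‖ = d at *
  generalize ‖P - X * Xᴴ‖ = k at *
  generalize ‖P - P₀‖ = p at *
  rcases le_or_gt d 0 with h0 | h0
  · exact (mul_nonpos_of_nonneg_of_nonpos hab.le h0).trans (by positivity)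
  · refine le_of_mul_le_mul_right ?_ h0
    have h1 : d ^ 2 ≤ (1 + ε) * (p ^ 2 + k ^ 2) := hsub.trans (by gcongr)
    have h2 := mul_le_mul_of_nonneg_left h1 hab.le
    have h3 := mul_le_mul_of_nonneg_left hloc (by linarith : 0 ≤ 2 * (1 + ε))
    linarith

theorem exists_penalty_bound (h : SpectralGap H P₀ m a b) (hVV : Vᴴ * V = 1) (hVP : V * Vᴴ = P₀)
    {α : ℝ} (hα : α ∈ Set.Ioo (0 : ℝ) 1) :
    ∃ μ₀ : ℝ, 0 < μ₀ ∧ ∀ μ : ℝ, 0 < μ → μ < μ₀ → ∀ X ∈ S H m μ,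
      IsUnit (Xᴴ * X) ∧
      ‖Ptilde X - P₀‖ ≤ 2 * μ * m * √(N : ℝ) / (α ^ 2 * (a - b)) ∧
      ‖P X - P₀‖ ≤ 4 * μ * m * √(N : ℝ) / (α ^ 2 * (a - b)) := by
  have hab := sub_pos.2 h.lt
  obtain ⟨hα0, hα1⟩ := hα
  have hα2 : 0 < α ^ 2 := by positivity
  -- The second entry gives `α² (1 + ε) ≤ 1`; `1 / 3` is the smallness required by
  -- `quadratic_growth_bounds`.
  set ε := min (1 / 3) ((1 - α ^ 2) / α ^ 2) with hεdef
  have hε : 0 < ε := lt_min (by norm_num) (div_pos (by nlinarith) hα2)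
  have hεα : α ^ 2 * (1 + ε) ≤ 1 := by
    have : ε ≤ (1 - α ^ 2) / α ^ 2 := min_le_right _ _
    rw [le_div_iff₀ hα2] at this
    linarith
  -- This threshold makes the crude excess bound at most `(a - b) ε² / 2`; the `+ 1` keeps the
  -- denominator positive.
  refine ⟨(a - b) * ε ^ 2 / (2 * (√(N : ℝ) * m + 1)), by positivity, fun μ hμ hμ₀ X hX => ?_⟩
  have hμε : 2 * (μ * (√(N : ℝ) * m)) ≤ (a - b) * ε ^ 2 := by
    rw [lt_div_iff₀ (by positivity)] at hμ₀
    linarith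
  obtain ⟨hd, hb⟩ := h.norm_sub_le_of_mem_S hVV hVP hμ.le hε.le (min_le_left _ _) hμε hX
  have hunit : IsUnit (Xᴴ * X) :=
    isUnit_conjTranspose_mul_self hVV (by rw [hVP]; linarith)
  have h1 : ‖X * Xᴴ - P₀‖ ≤ 2 * μ * m * √(N : ℝ) / (α ^ 2 * (a - b)) := by
    rw [le_div_iff₀ (by positivity)]
    have hc : 0 ≤ 2 * μ * m * √(N : ℝ) := by positivity
    have := mul_le_mul_of_nonneg_left hb hα2.le
    have := mul_le_mul_of_nonneg_left hεα hc
    linarith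
  refine ⟨hunit, h1, ?_⟩
  have h2 := norm_P_sub_le hunit h.proj h.trace_re
  calc ‖P X - P₀‖ ≤ ‖P X - X * Xᴴ‖ + ‖X * Xᴴ - P₀‖ := norm_sub_le_norm_sub_add_norm_sub _ _ _
    _ ≤ 2 * (2 * μ * m * √(N : ℝ) / (α ^ 2 * (a - b))) := by linarith
    _ = _ := by ring

end SpectralGap

end OMM

/-! ### Diagonalization of `H` and the spectral projector. -/

namespace OMM

lemma sum_castLE {m N : ℕ} (h : m ≤ N) (f : Fin N → ℂ) :
    ∑ j : Fin m, f (Fin.castLE h j) = ∑ k : Fin N, if (k : ℕ) < m then f k else 0 := by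
  obtain ⟨c, rfl⟩ := Nat.exists_eq_add_of_le h
  rw [Fin.sum_univ_add]
  simp
  rfl

section Spectral

variable {N m : ℕ} {H : Matrix (Fin N) (Fin N) ℂ}

lemma eig_monotone (hH : H.IsHermitian) : Monotone (eig hH) := fun _ _ hij =>
  hH.eigenvalues₀_antitone (by
    simpa [Fin.le_def] using Nat.sub_le_sub_left (Nat.succ_le_succ hij) N)

lemma exists_diagonalization (hH : H.IsHermitian) :
    ∃ U : Matrix (Fin N) (Fin N) ℂ, Uᴴ * U = 1 ∧
      H * U = U * Matrix.diagonal fun k => (eig hH k : ℂ) := by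
  -- `eigenvalues₀` is decreasing and `eigenvalues` is indexed through a cardinality equivalence;
  -- `σ` undoes both.
  let σ : Fin N ≃ Fin N := Fin.revPerm.trans ((finCongr (Fintype.card_fin N).symm).trans
    (Fintype.equivOfCardEq (Fintype.card_fin _)))
  have hσ : ∀ k, hH.eigenvalues (σ k) = eig hH k := by
    intro k
    simp [Matrix.IsHermitian.eigenvalues, eig, σ]
  let U := (hH.eigenvectorUnitary : Matrix (Fin N) (Fin N) ℂ)
  have hU : Uᴴ * U = 1 := Unitary.coe_star_mul_self hH.eigenvectorUnitary
  refine ⟨U.submatrix id σ, ?_, ?_⟩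
  · rw [Matrix.conjTranspose_submatrix,
      ← Matrix.submatrix_mul _ _ _ _ _ Function.bijective_id, hU, Matrix.submatrix_one_equiv]
  · ext i k
    have := congrFun (hH.mulVec_eigenvectorBasis (σ k)) i
    rw [hσ] at this
    rw [Matrix.mul_diagonal]
    simp only [Pi.smul_apply, Complex.real_smul] at this
    rw [Matrix.submatrix_apply, mul_comm]
    exact this

variable {U : Matrix (Fin N) (Fin N) ℂ}

lemma submatrix_castLE_mul_conjTranspose (hmN : m ≤ N) :
    U.submatrix id (Fin.castLE hmN) * (U.submatrix id (Fin.castLE hmN))ᴴ =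
      U * Matrix.diagonal (fun k : Fin N => if (k : ℕ) < m then (1 : ℂ) else 0) * Uᴴ := by
  ext i j
  rw [Matrix.mul_apply, Matrix.mul_apply]
  simp only [Matrix.mul_diagonal, Matrix.conjTranspose_apply, Matrix.submatrix_apply, id]
  rw [sum_castLE hmN (fun k => U i k * star (U j k))]
  refine Finset.sum_congr rfl fun k _ => ?_
  split_ifs <;> simp

lemma posSemidef_conj_diagonal {d : Fin N → ℝ} (hd : ∀ k, 0 ≤ d k) :
    (U * Matrix.diagonal (fun k => (d k : ℂ)) * Uᴴ).PosSemidef := by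
  refine Matrix.PosSemidef.mul_mul_conjTranspose_same (Matrix.PosSemidef.diagonal fun k => ?_) U
  simpa using hd k

/-- Both sides are compared on the eigenvectors `u k`. For `k ≥ m` the gap puts `u k` in an
eigenspace orthogonal to every low-lying one. -/
lemma P0_eq (hH : H.IsHermitian) (hU : Uᴴ * U = 1)
    (hHU : H * U = U * Matrix.diagonal fun k => (eig hH k : ℂ))
    (hgap : ∀ j k : Fin N, (j : ℕ) < m → m ≤ (k : ℕ) → eig hH j ≠ eig hH k) :
    P0 hH m = U * Matrix.diagonal (fun k : Fin N => if (k : ℕ) < m then (1 : ℂ) else 0) * Uᴴ := by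
  set D := Matrix.diagonal (fun k : Fin N => if (k : ℕ) < m then (1 : ℂ) else 0)
  let u : Fin N → EuclideanSpace ℂ (Fin N) := fun k => WithLp.toLp 2 (U.col k)
  have hcol : ∀ (A : Matrix (Fin N) (Fin N) ℂ) (d : Fin N → ℂ), A * U = U * Matrix.diagonal d →
      ∀ k, Matrix.toEuclideanLin A (u k) = d k • u k := by
    intro A d hA k
    ext i
    have := congrFun (congrFun hA i) k
    rw [Matrix.mul_diagonal, mul_comm (U i k)] at this
    exact this
  have hu : ∀ k, u k ∈ Module.End.eigenspace (Matrix.toEuclideanLin H) ((eig hH k : ℝ) : ℂ) :=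
    fun k => Module.End.mem_eigenspace_iff.2 (hcol H _ hHU k)
  have hsym := Matrix.isSymmetric_toEuclideanLin_iff.2 hH
  have hproj : ∀ k, (lowEigenspace hH m).starProjection (u k) =
      (if (k : ℕ) < m then (1 : ℂ) else 0) • u k := by
    intro k
    split_ifs with hk
    · rw [one_smul, Submodule.starProjection_eq_self_iff]
      exact Submodule.mem_iSup_of_mem k (Submodule.mem_iSup_of_mem hk (hu k))
    · rw [zero_smul, Submodule.starProjection_apply_eq_zero_iff]
      have hle : lowEigenspace hH m ≤ (ℂ ∙ u k)ᗮ := by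
        refine iSup_le fun j => iSup_le fun hj w hw => ?_
        rw [Submodule.mem_orthogonal_singleton_iff_inner_right]
        have hne : ((eig hH k : ℝ) : ℂ) ≠ ((eig hH j : ℝ) : ℂ) :=
          fun h => hgap j k hj (not_lt.1 hk) (Complex.ofReal_injective h).symm
        exact hsym.orthogonalFamily_eigenspaces hne ⟨u k, hu k⟩ ⟨w, hw⟩
      rw [Submodule.mem_orthogonal']
      intro w hw
      exact Submodule.mem_orthogonal_singleton_iff_inner_right.1 (hle hw)
  have hUU : U * Uᴴ = 1 := mul_eq_one_comm.1 hU
  have hP : P0 hH m * U = U * D := by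
    ext i k
    have h1 := hproj k
    have h2 : Matrix.toEuclideanLin (P0 hH m) (u k) =
        (lowEigenspace hH m).starProjection (u k) := by
      rw [P0, LinearEquiv.apply_symm_apply]
      rfl
    rw [← h2] at h1
    have h3 := congrArg (fun w : EuclideanSpace ℂ (Fin N) => w i) h1
    rw [Matrix.mul_diagonal, mul_comm (U i k)]
    exact h3
  rw [← hP, Matrix.mul_assoc, hUU, Matrix.mul_one]

/-- Indices start at 0, so `i` and `j` carry `λ_m` and `λ_{m+1}`. All matrices involved are diagonal
in the basis `U`, and each semidefiniteness is read off the eigenvalues. -/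
lemma spectralGap_P0 {i j : Fin N} (hi : (i : ℕ) + 1 = m) (hj : (j : ℕ) = m) (hH : H.IsHermitian)
    (hneg : (-H).PosDef) (hgap : eig hH i < eig hH j) :
    SpectralGap H (P0 hH m) m (-eig hH i) (-eig hH j) ∧
      ∃ V : Matrix (Fin N) (Fin m) ℂ, Vᴴ * V = 1 ∧ V * Vᴴ = P0 hH m := by
  have hmN : m ≤ N := hj ▸ j.2.le
  obtain ⟨U, hU, hHU⟩ := exists_diagonalization hH
  have hUU : U * Uᴴ = 1 := mul_eq_one_comm.1 hU
  have hlow : ∀ k : Fin N, (k : ℕ) < m → eig hH k ≤ eig hH i := fun k hk =>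
    eig_monotone hH (Fin.le_def.2 (by omega))
  have hhigh : ∀ k : Fin N, m ≤ (k : ℕ) → eig hH j ≤ eig hH k := fun k hk =>
    eig_monotone hH (Fin.le_def.2 (by omega))
  have hP := P0_eq (m := m) hH hU hHU fun l k hl hk =>
    ((hlow l hl).trans_lt (hgap.trans_le (hhigh k hk))).ne
  have hnonpos : ∀ k, eig hH k ≤ 0 := by
    intro k
    have h1 : (Uᴴ * -H * U) k k = ((-eig hH k : ℝ) : ℂ) := by
      rw [Matrix.mul_assoc, Matrix.neg_mul, hHU, Matrix.mul_neg, ← Matrix.mul_assoc, hU,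
        Matrix.one_mul]
      simp
    have h2 := (hneg.posSemidef.conjTranspose_mul_mul_same U).diag_nonneg (i := k)
    rw [h1] at h2
    linarith [Complex.zero_le_real.1 h2]
  set V := U.submatrix id (Fin.castLE hmN) with hVdef
  have hVV : Vᴴ * V = 1 := by
    rw [hVdef, Matrix.conjTranspose_submatrix,
      ← Matrix.submatrix_mul _ _ _ _ _ Function.bijective_id, hU]
    exact Matrix.submatrix_one _ (Fin.castLE_injective hmN)
  have hVP : V * Vᴴ = P0 hH m := by rw [hP, hVdef, submatrix_castLE_mul_conjTranspose]
  refine ⟨?_, V, hVV, hVP⟩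
  have hconj : ∀ {A : Matrix (Fin N) (Fin N) ℂ} (d : Fin N → ℝ), (∀ k, 0 ≤ d k) →
      A * U = U * Matrix.diagonal (fun k => (d k : ℂ)) → A.PosSemidef := by
    intro A d hd hA
    have := posSemidef_conj_diagonal (U := U) hd
    rwa [← hA, Matrix.mul_assoc, hUU, Matrix.mul_one] at this
  have hPU : P0 hH m * U
      = U * Matrix.diagonal (fun k : Fin N => if (k : ℕ) < m then (1 : ℂ) else 0) := by
    rw [hP, Matrix.mul_assoc, hU, Matrix.mul_one]
  have hmul : ∀ d : Fin N → ℂ, ∀ c : ℂ, c • (U * Matrix.diagonal d)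
      = U * Matrix.diagonal (fun k => c * d k) := by
    intro d c
    rw [← Matrix.mul_smul, ← Matrix.diagonal_smul]
    rfl
  have hHPU : H * P0 hH m * U = U * Matrix.diagonal
      (fun k : Fin N => if (k : ℕ) < m then (eig hH k : ℂ) else 0) := by
    rw [Matrix.mul_assoc, hPU, ← Matrix.mul_assoc, hHU, Matrix.mul_assoc,
      Matrix.diagonal_mul_diagonal]
    simp
  refine ⟨hVP ▸ isProjector_mul_conjTranspose hVV, ?_, ?_, ?_, ?_, ?_, ?_⟩
  · rw [← hVP, Matrix.trace_mul_comm, hVV, Matrix.trace_one]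
    simp
  · refine hconj (fun k => if (k : ℕ) < m then eig hH i - eig hH k else 0) ?_ ?_
    · intro k
      split_ifs with hk
      · linarith [hlow k hk]
      · exact le_rfl
    · rw [Matrix.sub_mul, Matrix.smul_mul, hPU, hmul, Matrix.neg_mul, Matrix.neg_mul, hHPU,
        ← Matrix.mul_neg, ← Matrix.mul_sub, Matrix.diagonal_neg, Matrix.diagonal_sub]
      congr 2
      ext k
      split_ifs <;> push_cast <;> ring
  · refine hconj (fun k => if (k : ℕ) < m then 0 else eig hH k - eig hH j) ?_ ?_
    · intro k
      split_ifs with hk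
      · exact le_rfl
      · linarith [hhigh k (not_lt.1 hk)]
    · have hU1 : (1 : Matrix (Fin N) (Fin N) ℂ) * U = U * Matrix.diagonal (fun _ => 1) := by simp
      rw [Matrix.mul_sub, Matrix.mul_one, Matrix.add_mul, Matrix.smul_mul, Matrix.sub_mul,
        Matrix.sub_mul, hU1, hPU, hHPU, hHU, ← Matrix.mul_sub, ← Matrix.mul_sub,
        Matrix.diagonal_sub, Matrix.diagonal_sub, hmul, ← Matrix.mul_add, Matrix.diagonal_add]
      congr 2
      ext k
      split_ifs <;> push_cast <;> ring
  · refine hconj (fun k => if (k : ℕ) < m then eig hH i - eig hH k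
      else - eig hH k) ?_ ?_
    · intro k
      split_ifs with hk
      · linarith [hlow k hk]
      · linarith [hnonpos k]
    · rw [Matrix.sub_mul, Matrix.smul_mul, hPU, hmul, Matrix.neg_mul, hHU,
        ← Matrix.mul_neg, ← Matrix.mul_sub, Matrix.diagonal_neg, Matrix.diagonal_sub]
      congr 2
      ext k
      split_ifs <;> push_cast <;> ring
  · linarith [hnonpos j]
  · linarith

end Spectral

end OMM

theorem corollary2p11 {N m : ℕ} (hm : 1 ≤ m) (hmN : m < N)
    (H : Matrix (Fin N) (Fin N) ℂ) (hH : H.IsHermitian) (hneg : (-H).PosDef)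
    (hgap : OMM.eig hH ⟨m - 1, by omega⟩ < OMM.eig hH ⟨m, hmN⟩)
    (α : ℝ) (hα : α ∈ Set.Ioo (0 : ℝ) 1) :
    ∃ μ₀ : ℝ, 0 < μ₀ ∧ ∀ μ : ℝ, 0 < μ → μ < μ₀ → ∀ X ∈ OMM.S H m μ,
      IsUnit (Xᴴ * X) ∧
      ‖OMM.Ptilde X - OMM.P0 hH m‖ ≤ 2 * μ * m * √(N : ℝ) /
        (α ^ 2 * (OMM.eig hH ⟨m, hmN⟩ - OMM.eig hH ⟨m - 1, by omega⟩)) ∧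
      ‖OMM.P X - OMM.P0 hH m‖ ≤ 4 * μ * m * √(N : ℝ) /
        (α ^ 2 * (OMM.eig hH ⟨m, hmN⟩ - OMM.eig hH ⟨m - 1, by omega⟩)) := by
  obtain ⟨h, V, hVV, hVP⟩ := OMM.spectralGap_P0 (Nat.sub_add_cancel hm) rfl hH hneg hgap
  have := h.exists_penalty_bound hVV hVP hα
  rwa [neg_sub_neg] at this
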